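/- Let $d\ge 1$ and let $\mathcal X_d=\{\langle k,i\rangle : k\ge 0,\ 1\le i\le d\}$; the type $\langle k,i\rangle$ is said to have level $k$. Let $\{\mathbf Z_n\}_{n\ge 0}$ be a multitype Galton--Watson process with type set $\mathcal X_d$: each individual lives for one generation and, independently of all others, at death produces a finite offspring vector $\mathbf r=(r_j)_{j\in\mathcal X_d}$ of non-negative integers with a law $p_i(\cdot)$ that depends on its type $i$, where an individual of level $k$ has no offspring of level larger than $k+1$ (a block lower Hessenberg branching process). The process is irreducible if for all $i,j\in\mathcal X_d$ there is a path from $i$ to $j$ in the directed graph on $\mathcal X_d$ with an edge $a\to b$ whenever $M(a,b)>0$, where $M(a,b)\in[0,\infty]$ is the expected number of type-$b$ children of a type-$a$ parent. Let $A\subseteq\mathcal X_d$. For $i\in\mathcal X_d$ let $q_{0,i}(A)$ be the probability that, starting from a single individual of type $i$, no individual with type in $A$ is present in any generation $n\ge 0$, and let $\mathbf q_0(A)=(q_{0,i}(A))_{i\in\mathcal X_d}$. For $\ell\ge 0$ let $\mathbf q^{(-1,\ell)}(A)$ be the vector of extinction probabilities (indexed by the initial type) of the process $\{\mathbf Z^{(-1,\ell)}_n(A)\}$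 obtained from $\{\mathbf Z_n\}$ by making all individuals with type in $A$ immortal and all individuals with type outside $A$ and level larger than $\ell$ sterile, all other individuals reproducing as in $\{\mathbf Z_n\}$. That is, the progeny generating function of this process is $0$ for the types in $A$, is $1$ for the types outside $A$ of level larger than $\ell$, and is that of $\{\mathbf Z_n\}$ for all other types. If $\{\mathbf Z_n\}$ is irreducible and $A$ is non-empty, then \[ \lim_{\ell\to\infty}\mathbf q^{(-1,\ell)}(A)=\mathbf q_0(A) \] entrywise. -/

import Mathlib

open Filter Topology MeasureTheory ProbabilityTheory
open scoped ENNReal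

noncomputable section

namespace Branching

/-- The type set: the type `⟨k, i⟩` has level `k ≥ 0` and one of `d` phases. -/
abbrev Ty (d : ℕ) : Type := ℕ × Fin d

/-- Offspring vectors (finitely many children in total): `r j` is the number of children of
type `j`. -/
abbrev Offspring (d : ℕ) : Type := Ty d →₀ ℕ

/-- The countable set of offspring vectors carries the discrete σ-algebra. -/
instance (d : ℕ) : MeasurableSpace (Offspring d) := ⊤

/-- The set `T_k` of types whose level is at most `k`; it is empty for `k = -1`. -/
def levelsUpTo (d : ℕ) (k : ℤ) : Set (Ty d) := {j | (j.1 : ℤ) ≤ k}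

/-- The offspring vectors available to a parent of level `k`: there are no children of a level
larger than `k + 1`. -/
def allowed (d k : ℕ) : Set (Offspring d) := {r | ∀ j : Ty d, k + 2 ≤ j.1 → r j = 0}

/-- The offspring distributions of a block lower Hessenberg branching process. -/
structure BlockLHBP (d : ℕ) where
  /-- The offspring law of a parent of type `i`. -/
  law : Ty d → PMF (Offspring d)
  law_allowed : ∀ i : Ty d, (law i).support ⊆ allowed d i.1

/-- Virtual individuals (Ulam-Harris labels): a root of some type, or the child number `m`
(counted from `0`) of type `j` of a virtual individual. -/
inductive Individual (d : ℕ) : Type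
  | root (i : Ty d) : Individual d
  | child (I : Individual d) (m : ℕ) (j : Ty d) : Individual d

namespace Individual

variable {d : ℕ}

/-- The type of a virtual individual. -/
def type : Individual d → Ty d
  | root i => i
  | child _ _ j => j

/-- The type of the root of the line of descent. -/
def initial : Individual d → Ty d
  | root i => i
  | child I _ _ => I.initial

/-- The generation of a virtual individual. -/
def generation : Individual d → ℕ
  | root _ => 0
  | child I _ _ => I.generation + 1

end Individual

/-- The sample space: an outcome assigns an offspring vector to every virtual individual. -/
abbrev Outcome (d : ℕ) : Type := Individual d → Offspring d

variable {d : ℕ}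

/-- The individual `I` appears in the population that descends from its root. -/
def Appears (N : Outcome d) : Individual d → Prop
  | .root _ => True
  | .child I m j => Appears N I ∧ m < N I j

/-- `Z_{n,j}`: the number of individuals of type `j` in generation `n`, for a population started
by one individual of type `i`. -/
def population (N : Outcome d) (i : Ty d) (n : ℕ) (j : Ty d) : ℕ∞ :=
  {I : Individual d | I.initial = i ∧ I.generation = n ∧ I.type = j ∧ Appears N I}.encard

/-- The event that, for a population started in type `i`, no individual with type in `A` is
present from generation `n` on. -/
def absentFrom (n : ℕ) (A : Set (Ty d)) (i : Ty d) : Set (Outcome d) :=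
  {N | ∀ m, n ≤ m → ∀ j ∈ A, population N i m j = 0}

open Classical in
/-- What happens to `I` in the modified process with parameters `k, ℓ, A`. The value `none`
means that `I` is immortal (generating function `0`): these are the individuals with type in `A`
and level above `k`. Individuals with type outside `A` and level above `ℓ` are sterile. All others
reproduce as in the original process. -/
def modifiedOffspring (k l : ℤ) (A : Set (Ty d)) (N : Outcome d) (I : Individual d) :
    Option (Offspring d) :=
  if I.type ∈ A ∩ (levelsUpTo d k)ᶜ then none
  else if I.type ∈ Aᶜ ∩ (levelsUpTo d l)ᶜ then some 0
  else some (N I)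

/-- The individual `I` is ever born in the modified process. -/
def ModAppears (k l : ℤ) (A : Set (Ty d)) (N : Outcome d) : Individual d → Prop
  | .root _ => True
  | .child I m j => ModAppears k l A N I ∧ ∃ r, modifiedOffspring k l A N I = some r ∧ m < r j

/-- The number of individuals of type `j` that are alive at time `n` in the modified process
started by one individual of type `i`. An individual lives for the single generation in which it
is born, except that an immortal one stays alive for ever. -/
def modPopulation (k l : ℤ) (A : Set (Ty d)) (N : Outcome d) (i : Ty d) (n : ℕ) (j : Ty d) : ℕ∞ :=
  {I : Individual d | I.initial = i ∧ I.type = j ∧ ModAppears k l A N I ∧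
    (I.generation = n ∨ (I.generation ≤ n ∧ modifiedOffspring k l A N I = none))}.encard

/-- The event that the modified process started in type `i` becomes extinct. -/
def modExtinct (k l : ℤ) (A : Set (Ty d)) (i : Ty d) : Set (Outcome d) :=
  {N | ∃ n, ∀ m, n ≤ m → ∀ j, modPopulation k l A N i m j = 0}

namespace BlockLHBP

variable (Z : BlockLHBP d)

/-- The virtual individuals have independent offspring vectors, and the one of `I` is distributed
according to the offspring law of the type of `I`. -/
def prob : Measure (Outcome d) := Measure.infinitePi fun I => (Z.law I.type).toMeasure

/-- The mean progeny matrix: the expected number of type-`j` children of a type-`i` parent,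
possibly infinite. -/
def mean (i j : Ty d) : ℝ≥0∞ := ∑' r : Offspring d, Z.law i r * (r j : ℝ≥0∞)

/-- There is a path between any two types in the mean progeny representation graph. -/
def Irreducible : Prop := ∀ i j : Ty d, Relation.ReflTransGen (fun a b => 0 < Z.mean a b) i j

/-- The vector `q_n(A)`; in particular `q_0(A)` is the vector of the probabilities that no
individual with type in `A` is ever produced. -/
def qAbsent (n : ℕ) (A : Set (Ty d)) (i : Ty d) : ℝ := Z.prob.real (absentFrom n A i)

/-- The vector `q^{(k,ℓ)}(A)` of the extinction probabilities of the modified process. -/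
def qMod (k l : ℤ) (A : Set (Ty d)) (i : Ty d) : ℝ := Z.prob.real (modExtinct k l A i)

/-- The progeny generating function. -/
def genFun (i : Ty d) (s : Ty d → ℝ≥0∞) : ℝ≥0∞ :=
  ∑' r : Offspring d, Z.law i r * r.prod fun j m => s j ^ m

open Classical in
/-- The progeny generating function that the modified process is required to have. -/
def modGenFun (k l : ℤ) (A : Set (Ty d)) (i : Ty d) (s : Ty d → ℝ≥0∞) : ℝ≥0∞ :=
  if i ∈ A ∩ (levelsUpTo d k)ᶜ then 0
  else if i ∈ Aᶜ ∩ (levelsUpTo d l)ᶜ then 1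
  else Z.genFun i s

/-- The modified process does have this progeny generating function, when an immortal individual
contributes `0`. -/
theorem lintegral_modifiedOffspring (k l : ℤ) (A : Set (Ty d)) (I : Individual d)
    (s : Ty d → ℝ≥0∞) :
    ∫⁻ N, (modifiedOffspring k l A N I).elim 0 (fun r => r.prod fun j m => s j ^ m) ∂Z.prob
      = Z.modGenFun k l A I.type s := by
  have hP : IsProbabilityMeasure Z.prob := by unfold prob; infer_instance
  unfold modifiedOffspring modGenFun
  split_ifs with h1 h2
  · simp
  · simp
  · have hm : Measurable fun r : Offspring d => r.prod fun j m => s j ^ m := measurable_from_top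
    have hmap : Z.prob.map (fun N => N I) = (Z.law I.type).toMeasure :=
      (measurePreserving_eval_infinitePi (fun I : Individual d => (Z.law I.type).toMeasure) I).map_eq
    have := lintegral_map (μ := Z.prob) hm (measurable_pi_apply I)
    simp only [Option.elim_some]
    rw [← this, hmap, lintegral_countable']
    unfold genFun
    refine tsum_congr fun r => ?_
    rw [PMF.toMeasure_apply_singleton _ _ (by trivial), mul_comm]

end BlockLHBP

end Branching

end

/-!
A path of positive mean offspring numbers from `x` to `A` gives every individual of type `x` a
descendant with type in `A` with probability at least some `ε > 0`, independently of the past. So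
whenever generation `n` contains type `x`, the conditional probability, given the past, that `A` is
absent from some fixed generation on is at most `1 - ε`. By Lévy's zero-one law this conditional
probability tends to `1` almost surely on that event, which therefore allows only finitely many
visits to `x`, and hence only finitely many to the finite set of types of level at most `ℓ`.

Consequently, almost surely, if `A` is never visited then every modified process becomes extinct.
If `A` is visited, then some individual with type in `A` has no ancestor with type in `A`; it is
born in the modified process, and is immortal there, once `ℓ` exceeds the levels of its ancestors.
-/

namespace Branching

section ConditionalProbability

theorem ae_notMem_of_frequently_condExp_le {Ω : Type*} {m0 : MeasurableSpace Ω} {μ : Measure Ω}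
    [IsFiniteMeasure μ] {ℱ : Filtration ℕ m0} {F : Set Ω} (hF : MeasurableSet[⨆ n, ℱ n] F)
    {c : ℝ} (hc : c < 1) :
    ∀ᵐ ω ∂μ, (∃ᶠ n in atTop, (μ⟦F | ℱ n⟧) ω ≤ c) → ω ∉ F := by
  have hF_int : Integrable (F.indicator fun _ => (1 : ℝ)) μ :=
    (integrable_const 1).indicator (iSup_le ℱ.le _ hF)
  filter_upwards [hF_int.tendsto_ae_condExp (stronglyMeasurable_const.indicator hF)]
    with ω h_levy h_freq hωF
  rw [Set.indicator_of_mem hωF] at h_levy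
  exact h_freq ((h_levy.eventually_const_lt hc).mono fun _ => not_le_of_gt)

theorem ae_condExp_indicator_le_of_inter_subset {Ω : Type*} {m m' m0 : MeasurableSpace Ω}
    {μ : Measure Ω} [IsFiniteMeasure μ] (hm : m ≤ m0) (hm' : m' ≤ m0) (h_indep : Indep m' m μ)
    {F B C : Set Ω} (hF : MeasurableSet F) (hB : MeasurableSet[m] B) (hC : MeasurableSet[m'] C)
    (h_subset : F ∩ B ⊆ C) : ∀ᵐ ω ∂μ, ω ∈ B → (μ⟦F | m⟧) ω ≤ μ.real C := by
  have hF_int : Integrable (F.indicator fun _ => (1 : ℝ)) μ := (integrable_const 1).indicator hF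
  have h_indicator : B.indicator (F.indicator fun _ => (1 : ℝ)) ≤ C.indicator fun _ => 1 := by
    rw [Set.indicator_indicator, Set.inter_comm]
    exact Set.indicator_le_indicator_of_subset h_subset fun _ => zero_le_one
  filter_upwards [condExp_indicator hF_int hB,
    condExp_mono (m := m) (hF_int.indicator (hm _ hB))
      ((integrable_const (1 : ℝ)).indicator (hm' _ hC)) (.of_forall h_indicator),
    condExp_indep_eq hm' hm
      ((stronglyMeasurable_const (β := ℝ) (b := 1)).indicator hC) h_indep]
    with ω h_pull h_mono h_const hωB
  rw [h_pull, Set.indicator_of_mem hωB, h_const, integral_indicator_const 1 (hm' _ hC)] at h_mono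
  simpa only [smul_eq_mul, mul_one] using h_mono

theorem indep_cylinderEvents_infinitePi {ι : Type*} {X : ι → Type*}
    {_ : ∀ i, MeasurableSpace (X i)} (P : ∀ i, Measure (X i)) [∀ i, IsProbabilityMeasure (P i)]
    {S T : Set ι} (hST : Disjoint S T) :
    Indep (cylinderEvents (X := X) S) (cylinderEvents T) (Measure.infinitePi P) :=
  indep_iSup_of_disjoint (fun i => (measurable_pi_apply i).comap_le)
    (iIndepFun_infinitePi (P := P) (X := fun _ x => x) fun _ => measurable_id) hST

end ConditionalProbability

deriving instance Countable for Individual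

variable {d : ℕ}

section Population

/-- In the outcome `N`, the individual `I` has the child `J`. Whether `I` itself appears in a
population is immaterial. -/
def IsChild (N : Outcome d) (I J : Individual d) : Prop :=
  ∃ m j, m < N I j ∧ J = .child I m j

/-- In the outcome `N`, the individual `J` is `I` or is born into the population that descends
from `I`. -/
def IsDescendant (N : Outcome d) : Individual d → Individual d → Prop :=
  Relation.ReflTransGen (IsChild N)

theorem isDescendant_root_iff {N : Outcome d} {I : Individual d} {i : Ty d} :
    IsDescendant N I (.root i) ↔ I = .root i := by
  rw [IsDescendant, Relation.ReflTransGen.cases_tail_iff, eq_comm]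
  simp [IsChild]

theorem isDescendant_child_iff {N : Outcome d} {I J : Individual d} {m : ℕ} {j : Ty d} :
    IsDescendant N I (.child J m j) ↔
      I = .child J m j ∨ IsDescendant N I J ∧ m < N J j := by
  rw [IsDescendant, Relation.ReflTransGen.cases_tail_iff, eq_comm]
  simp [IsChild, -Prod.exists]

theorem appears_iff_isDescendant_root {N : Outcome d} {J : Individual d} :
    Appears N J ↔ IsDescendant N (.root J.initial) J := by
  induction J with
  | root i => simp [Appears, Individual.initial, isDescendant_root_iff]
  | child J m j ih => simp [Appears, Individual.initial, isDescendant_child_iff, ih]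

theorem IsDescendant.initial_eq {N : Outcome d} {I J : Individual d} (h : IsDescendant N I J) :
    J.initial = I.initial := by
  induction h with
  | refl => rfl
  | tail _ h_child ih =>
    obtain ⟨m, j, -, rfl⟩ := h_child
    exact ih

theorem IsDescendant.generation_le {N : Outcome d} {I J : Individual d}
    (h : IsDescendant N I J) : I.generation ≤ J.generation := by
  induction h with
  | refl => rfl
  | tail _ h_child ih =>
    obtain ⟨m, j, -, rfl⟩ := h_child
    exact ih.trans (Nat.le_succ _)

theorem Appears.of_isDescendant {N : Outcome d} {I J : Individual d} (hI : Appears N I)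
    (h : IsDescendant N I J) : Appears N J := by
  rw [appears_iff_isDescendant_root] at hI ⊢
  rw [h.initial_eq]
  exact hI.trans h

theorem population_eq_zero_iff {N : Outcome d} {i : Ty d} {n : ℕ} {j : Ty d} :
    population N i n j = 0 ↔
      ∀ I : Individual d, I.initial = i → I.generation = n → I.type = j → ¬ Appears N I := by
  simp [population, Set.eq_empty_iff_forall_notMem]

theorem mem_absentFrom_iff {n : ℕ} {A : Set (Ty d)} {i : Ty d} {N : Outcome d} :
    N ∈ absentFrom n A i ↔
      ∀ I : Individual d, I.initial = i → n ≤ I.generation → I.type ∈ A → ¬ Appears N I := by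
  simp only [absentFrom, Set.mem_ofPred_eq, population_eq_zero_iff]
  constructor
  · exact fun h I hi hn hA => h _ hn _ hA I hi rfl rfl
  · rintro h m hm j hj I hi rfl rfl
    exact h I hi hm hj

/-- The event that the population descending from `I`, with `I` included, contains an individual
with type in `A`. -/
def progenyMeets (A : Set (Ty d)) (I : Individual d) : Set (Outcome d) :=
  {N | ∃ J : Individual d, J.type ∈ A ∧ IsDescendant N I J}

theorem progenyMeets_child_subset {A : Set (Ty d)} {I : Individual d} {m : ℕ} {j : Ty d} :
    {N : Outcome d | m < N I j} ∩ progenyMeets A (.child I m j) ⊆ progenyMeets A I :=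
  fun _ ⟨hm, J, hJA, hJ⟩ => ⟨J, hJA, .head ⟨m, j, hm, rfl⟩ hJ⟩

theorem absentFrom_inter_appears_subset {A : Set (Ty d)} {n : ℕ} {I : Individual d}
    (hn : n ≤ I.generation) :
    absentFrom n A I.initial ∩ {N | Appears N I} ⊆ (progenyMeets A I)ᶜ := by
  rintro N ⟨h_absent, hI⟩ ⟨J, hJA, hJ⟩
  exact mem_absentFrom_iff.1 h_absent J hJ.initial_eq (hn.trans hJ.generation_le) hJA
    (hI.of_isDescendant hJ)

end Population

section Measurability

theorem measurableSet_cylinderEvents_apply {S : Set (Individual d)} {I : Individual d}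
    (hI : I ∈ S) (B : Set (Offspring d)) :
    MeasurableSet[cylinderEvents S] {N : Outcome d | N I ∈ B} :=
  measurable_cylinderEvent_apply hI (MeasurableSpace.measurableSet_top (s := B))

theorem measurableSet_isDescendant (I J : Individual d) :
    MeasurableSet[cylinderEvents (Individual.generation ⁻¹' Set.Ico I.generation J.generation)]
      {N : Outcome d | IsDescendant N I J} := by
  induction J with
  | root i =>
    simp only [isDescendant_root_iff]
    exact @MeasurableSet.const _ (cylinderEvents _) _
  | child J m j ih =>
    simp only [isDescendant_child_iff]
    refine (@MeasurableSet.const _ (cylinderEvents _) _).union ?_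
    by_cases hgen : I.generation ≤ J.generation
    · refine MeasurableSet.inter (cylinderEvents_mono (fun L hL => ?_) _ ih)
        (measurableSet_cylinderEvents_apply (S := Individual.generation ⁻¹' Set.Ico _ _)
          ⟨hgen, Nat.lt_succ_self _⟩ {r | m < r j})
      exact ⟨hL.1, hL.2.trans (Nat.lt_succ_self _)⟩
    · simp only [fun N => mt (IsDescendant.generation_le (N := N)) hgen, false_and]
      exact @MeasurableSet.const _ (cylinderEvents _) _

theorem measurableSet_appears (I : Individual d) :
    MeasurableSet[cylinderEvents (Individual.generation ⁻¹' Set.Iio I.generation)]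
      {N : Outcome d | Appears N I} := by
  simp only [appears_iff_isDescendant_root]
  exact cylinderEvents_mono (fun _ hL => hL.2) _ (measurableSet_isDescendant _ I)

theorem measurableSet_progenyMeets (A : Set (Ty d)) (I : Individual d) :
    MeasurableSet[cylinderEvents (Individual.generation ⁻¹' Set.Ici I.generation)]
      (progenyMeets A I) := by
  simp only [progenyMeets, Set.ofPred_exists, Set.ofPred_and]
  exact .iUnion fun J => (@MeasurableSet.const _ (cylinderEvents _) _).inter
    (cylinderEvents_mono (fun _ hL => hL.1) _ (measurableSet_isDescendant I J))

theorem measurableSet_absentFrom (n : ℕ) (A : Set (Ty d)) (i : Ty d) :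
    MeasurableSet (absentFrom n A i) := by
  have h_eq : absentFrom n A i = {N | ∀ I : Individual d, I.initial = i → n ≤ I.generation →
      I.type ∈ A → ¬ Appears N I} := Set.ext fun _ => mem_absentFrom_iff
  simp only [h_eq, Set.ofPred_forall]
  exact .iInter fun I => .iInter fun _ => .iInter fun _ => .iInter fun _ =>
    (cylinderEvents_le_pi _ (measurableSet_appears I)).compl

/-- The filtration of a branching process: the information of time `n` consists of the offspring
vectors of the individuals of generation less than `n`, which determine the population up to
generation `n`. -/
def generationFiltration (d : ℕ) :
    Filtration ℕ (inferInstance : MeasurableSpace (Outcome d)) where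
  seq n := cylinderEvents (Individual.generation ⁻¹' Set.Iio n)
  mono' _ _ h := cylinderEvents_mono fun _ hI => lt_of_lt_of_le hI h
  le' _ := cylinderEvents_le_pi

theorem iSup_generationFiltration : ⨆ n, generationFiltration d n = MeasurableSpace.pi := by
  refine le_antisymm (iSup_le (generationFiltration d).le) (iSup_le fun I => ?_)
  refine le_iSup_of_le (I.generation + 1) (Measurable.comap_le ?_)
  exact measurable_cylinderEvent_apply (Nat.lt_succ_self I.generation)

end Measurability

namespace BlockLHBP

variable (Z : BlockLHBP d)

instance : IsProbabilityMeasure Z.prob := by unfold prob; infer_instance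

theorem indep_cylinderEvents {S T : Set (Individual d)} (hST : Disjoint S T) :
    Indep (cylinderEvents S) (cylinderEvents T) Z.prob :=
  indep_cylinderEvents_infinitePi _ hST

theorem prob_apply_eq (I : Individual d) (r : Offspring d) :
    Z.prob {N | N I = r} = Z.law I.type r := by
  have h_eval := measurePreserving_eval_infinitePi
    (fun I : Individual d => (Z.law I.type).toMeasure) I
  rw [← PMF.toMeasure_apply_singleton _ r MeasurableSpace.measurableSet_top,
    ← h_eval.measure_preimage MeasurableSpace.measurableSet_top.nullMeasurableSet]
  rfl

theorem mean_pos_iff {a b : Ty d} : 0 < Z.mean a b ↔ ∃ r, Z.law a r ≠ 0 ∧ 0 < r b := by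
  simp [mean, pos_iff_ne_zero, ENNReal.tsum_eq_zero]

theorem exists_pos_le_prob_progenyMeets {A : Set (Ty d)} {x y : Ty d}
    (hxy : Relation.ReflTransGen (fun a b => 0 < Z.mean a b) x y) (hy : y ∈ A) :
    ∃ ε : ℝ, 0 < ε ∧ ∀ I : Individual d, I.type = x → ε ≤ Z.prob.real (progenyMeets A I) := by
  induction hxy using Relation.ReflTransGen.head_induction_on with
  | refl =>
    refine ⟨1, one_pos, fun I hI => ?_⟩
    have h_univ : progenyMeets A I = Set.univ :=
      Set.eq_univ_of_forall fun N => ⟨I, hI ▸ hy, .refl⟩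
    rw [h_univ, probReal_univ]
  | @head x z hxz _ ih =>
    obtain ⟨ε, hε, h_bound⟩ := ih
    obtain ⟨r, hr, hrz⟩ := Z.mean_pos_iff.1 hxz
    refine ⟨(Z.law x r).toReal * ε,
      mul_pos (ENNReal.toReal_pos hr (PMF.apply_ne_top _ _)) hε, ?_⟩
    rintro I rfl
    have h_disjoint : Disjoint {I}
        (Individual.generation ⁻¹' Set.Ici (Individual.child I 0 z).generation) :=
      Set.disjoint_singleton_left.2 (Nat.not_succ_le_self I.generation)
    have h_meas : MeasurableSet[cylinderEvents {I}] {N : Outcome d | N I = r} :=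
      measurableSet_cylinderEvents_apply (Set.mem_singleton I) {r}
    have h_indep : Z.prob ({N | N I = r} ∩ progenyMeets A (.child I 0 z)) =
        Z.prob {N | N I = r} * Z.prob (progenyMeets A (.child I 0 z)) :=
      (Indep_iff _ _ _).1 (Z.indep_cylinderEvents h_disjoint) _ _ h_meas
        (measurableSet_progenyMeets A _)
    calc (Z.law I.type r).toReal * ε
        ≤ (Z.law I.type r).toReal * Z.prob.real (progenyMeets A (.child I 0 z)) := by
          gcongr
          exact h_bound _ rfl
      _ = Z.prob.real ({N | N I = r} ∩ progenyMeets A (.child I 0 z)) := by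
          rw [measureReal_def, measureReal_def, h_indep, prob_apply_eq, ENNReal.toReal_mul]
      _ ≤ Z.prob.real (progenyMeets A I) := by
          refine measureReal_mono fun N ⟨(hN : N I = r), h_meets⟩ => ?_
          exact progenyMeets_child_subset ⟨show 0 < N I z by rwa [hN], h_meets⟩

theorem ae_condExp_absentFrom_le (A : Set (Ty d)) {n : ℕ} {I : Individual d}
    (hn : n ≤ I.generation) :
    ∀ᵐ N ∂Z.prob, Appears N I →
      (Z.prob⟦absentFrom n A I.initial | generationFiltration d I.generation⟧) N ≤
        1 - Z.prob.real (progenyMeets A I) := by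
  have h_disjoint : Disjoint (Individual.generation (d := d) ⁻¹' Set.Ici I.generation)
      (Individual.generation ⁻¹' Set.Iio I.generation) :=
    (Set.Iio_disjoint_Ici le_rfl).symm.preimage _
  have h_meets := measurableSet_progenyMeets A I
  rw [← probReal_compl_eq_one_sub (cylinderEvents_le_pi _ h_meets)]
  exact ae_condExp_indicator_le_of_inter_subset ((generationFiltration d).le _)
    cylinderEvents_le_pi (Z.indep_cylinderEvents h_disjoint) (measurableSet_absentFrom n A _)
    (measurableSet_appears I) h_meets.compl (absentFrom_inter_appears_subset hn)

theorem ae_eventually_population_eq_zero {A : Set (Ty d)} {x y : Ty d}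
    (hxy : Relation.ReflTransGen (fun a b => 0 < Z.mean a b) x y) (hy : y ∈ A) (n : ℕ)
    (i : Ty d) :
    ∀ᵐ N ∂Z.prob, N ∈ absentFrom n A i → ∀ᶠ m in atTop, population N i m x = 0 := by
  obtain ⟨ε, hε, h_bound⟩ := Z.exists_pos_le_prob_progenyMeets hxy hy
  have h_visit : ∀ᵐ N ∂Z.prob, ∀ I : Individual d, n ≤ I.generation → Appears N I →
      (Z.prob⟦absentFrom n A I.initial | generationFiltration d I.generation⟧) N ≤
        1 - Z.prob.real (progenyMeets A I) :=
    ae_all_iff.2 fun I => eventually_imp_distrib_left.2 fun hn => Z.ae_condExp_absentFrom_le A hn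
  have h_absent : MeasurableSet[⨆ m, generationFiltration d m] (absentFrom n A i) := by
    rw [iSup_generationFiltration]
    exact measurableSet_absentFrom n A i
  filter_upwards [h_visit,
    ae_notMem_of_frequently_condExp_le (μ := Z.prob) h_absent (sub_lt_self 1 hε)]
    with N h_visit h_levy hN
  by_contra h_often
  refine h_levy (((not_eventually.1 h_often).and_eventually (eventually_ge_atTop n)).mono ?_) hN
  rintro m ⟨h_pop, hm⟩
  simp only [population_eq_zero_iff, not_forall, not_not] at h_pop
  obtain ⟨I, rfl, rfl, hx, hI⟩ := h_pop
  exact (h_visit I hm hI).trans (sub_le_sub_left (h_bound I hx) 1)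

end BlockLHBP

section ModifiedProcess

variable {k l : ℤ} {A : Set (Ty d)} {N : Outcome d} {I : Individual d}

/-- The types of the proper ancestors of an individual. -/
def Individual.ancestorTypes : Individual d → Set (Ty d)
  | root _ => ∅
  | child I _ _ => insert I.type I.ancestorTypes

theorem Individual.finite_ancestorTypes (I : Individual d) : I.ancestorTypes.Finite := by
  induction I with
  | root => exact Set.finite_empty
  | child _ _ _ ih => exact ih.insert _

theorem finite_levelsUpTo (l : ℤ) : (levelsUpTo d l).Finite := by
  refine ((Set.finite_Iic l.toNat).prod (Set.finite_univ (α := Fin d))).subset fun j hj => ?_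
  have hj_le : (j.1 : ℤ) ≤ l := hj
  exact ⟨Set.mem_Iic.2 (by lia), trivial⟩

theorem levelsUpTo_neg_one : levelsUpTo d (-1) = ∅ := by
  ext j
  simp only [levelsUpTo, Set.mem_ofPred_eq, Set.mem_empty_iff_false, iff_false]
  lia

/-- The types that are neither immortal nor sterile in the modified process with parameters
`k, ℓ, A`. -/
def reproducingTypes (k l : ℤ) (A : Set (Ty d)) : Set (Ty d) :=
  A ∩ levelsUpTo d k ∪ Aᶜ ∩ levelsUpTo d l

theorem modifiedOffspring_eq_none_iff :
    modifiedOffspring k l A N I = none ↔ I.type ∈ A ∩ (levelsUpTo d k)ᶜ := by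
  unfold modifiedOffspring
  split_ifs <;> simp_all

theorem exists_modifiedOffspring_gt_iff {m : ℕ} {j : Ty d} :
    (∃ r, modifiedOffspring k l A N I = some r ∧ m < r j) ↔
      I.type ∈ reproducingTypes k l A ∧ m < N I j := by
  unfold modifiedOffspring reproducingTypes
  split_ifs <;> grind

theorem modAppears_iff :
    ModAppears k l A N I ↔ Appears N I ∧ I.ancestorTypes ⊆ reproducingTypes k l A := by
  induction I with
  | root i => simp [ModAppears, Appears, Individual.ancestorTypes]
  | child I m j ih =>
    simp only [ModAppears, Appears, Individual.ancestorTypes, Set.insert_subset_iff, ih,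
      exists_modifiedOffspring_gt_iff]
    tauto

theorem mem_modExtinct_iff {i : Ty d} :
    N ∈ modExtinct k l A i ↔ ∃ n, ∀ m, n ≤ m → ∀ I : Individual d, I.initial = i →
      (I.generation = m ∨ I.generation ≤ m ∧ I.type ∈ A ∩ (levelsUpTo d k)ᶜ) →
        ¬ ModAppears k l A N I := by
  simp only [modExtinct, modPopulation, Set.mem_ofPred_eq, Set.encard_eq_zero,
    Set.eq_empty_iff_forall_notMem, modifiedOffspring_eq_none_iff]
  constructor
  · rintro ⟨n, hn⟩
    exact ⟨n, fun m hm I hi h_alive hI => hn m hm _ I ⟨hi, rfl, hI, h_alive⟩⟩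
  · rintro ⟨n, hn⟩
    exact ⟨n, fun m hm j I ⟨hi, _, hI, h_alive⟩ => hn m hm I hi h_alive hI⟩

theorem measurableSet_modExtinct (k l : ℤ) (A : Set (Ty d)) (i : Ty d) :
    MeasurableSet (modExtinct k l A i) := by
  have h_modAppears (I : Individual d) : MeasurableSet {N | ModAppears k l A N I} := by
    simp only [modAppears_iff]
    exact (cylinderEvents_le_pi _ (measurableSet_appears I)).inter (.const _)
  have h_eq : modExtinct k l A i = {N | ∃ n, ∀ m, n ≤ m → ∀ I : Individual d, I.initial = i →
      (I.generation = m ∨ I.generation ≤ m ∧ I.type ∈ A ∩ (levelsUpTo d k)ᶜ) →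
        ¬ ModAppears k l A N I} := Set.ext fun _ => mem_modExtinct_iff
  simp only [h_eq, Set.ofPred_exists, Set.ofPred_forall]
  exact .iUnion fun n => .iInter fun m => .iInter fun _ => .iInter fun I => .iInter fun _ =>
    .iInter fun _ => (h_modAppears I).compl

theorem Appears.exists_disjoint_ancestorTypes (hI : Appears N I) (hIA : I.type ∈ A) :
    ∃ J : Individual d, J.initial = I.initial ∧ J.type ∈ A ∧ Appears N J ∧
      Disjoint J.ancestorTypes A := by
  suffices h : Disjoint I.ancestorTypes A ∨ ∃ J : Individual d, J.initial = I.initial ∧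
      J.type ∈ A ∧ Appears N J ∧ Disjoint J.ancestorTypes A from
    h.elim (fun h => ⟨I, rfl, hIA, hI, h⟩) id
  clear hIA
  induction I with
  | root i => exact .inl (Set.empty_disjoint A)
  | child I m j ih =>
    rcases ih hI.1 with h | h
    · by_cases hIA : I.type ∈ A
      · exact .inr ⟨I, rfl, hIA, hI.1, h⟩
      · exact .inl (Set.disjoint_insert_left.2 ⟨hIA, h⟩)
    · exact .inr h

theorem eventually_notMem_modExtinct {i : Ty d} (hN : N ∉ absentFrom 0 A i) :
    ∀ᶠ l : ℕ in atTop, N ∉ modExtinct (-1) l A i := by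
  simp only [mem_absentFrom_iff, not_forall, not_not] at hN
  obtain ⟨I, hi, -, hIA, hI⟩ := hN
  obtain ⟨J, hJI, hJA, hJ, h_disj⟩ := hI.exists_disjoint_ancestorTypes hIA
  obtain ⟨L, hL⟩ := (J.finite_ancestorTypes.image Prod.fst).bddAbove
  filter_upwards [eventually_ge_atTop L] with l hl h_ext
  have h_anc : J.ancestorTypes ⊆ reproducingTypes (-1) l A := fun t ht => by
    have ht_level : t.1 ≤ l := (hL (Set.mem_image_of_mem _ ht)).trans hl
    exact .inr ⟨Set.disjoint_left.1 h_disj ht, by simpa [levelsUpTo] using ht_level⟩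
  have hJ_immortal : J.type ∈ A ∩ (levelsUpTo d (-1))ᶜ := ⟨hJA, by simp [levelsUpTo_neg_one]⟩
  obtain ⟨n, hn⟩ := mem_modExtinct_iff.1 h_ext
  exact hn (max n J.generation) (le_max_left _ _) J (hJI.trans hi)
    (.inr ⟨le_max_right _ _, hJ_immortal⟩) (modAppears_iff.2 ⟨hJ, h_anc⟩)

theorem mem_modExtinct_of_eventually {i : Ty d} (hN : N ∈ absentFrom 0 A i)
    (h_dies : ∀ᶠ m in atTop, ∀ j ∈ levelsUpTo d l, population N i m j = 0) :
    N ∈ modExtinct k l A i := by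
  rw [mem_absentFrom_iff] at hN
  obtain ⟨n, hn⟩ := eventually_atTop.1 h_dies
  refine mem_modExtinct_iff.2 ⟨n + 1, fun m hm I hi h_alive hI => ?_⟩
  obtain ⟨hI_app, h_anc⟩ := modAppears_iff.1 hI
  have hI_gen : I.generation = m :=
    h_alive.resolve_right fun h => hN I hi (Nat.zero_le _) h.2.1 hI_app
  cases I with
  | root => simp only [Individual.generation] at hI_gen; lia
  | child J a j =>
    have hJ_level : J.type ∈ levelsUpTo d l :=
      (h_anc (Set.mem_insert _ _)).elim
        (fun h => absurd hI_app.1 (hN J hi (Nat.zero_le _) h.1)) And.right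
    simp only [Individual.generation] at hI_gen
    exact population_eq_zero_iff.1 (hn J.generation (by lia) _ hJ_level) J hi rfl rfl hI_app.1

end ModifiedProcess

theorem BlockLHBP.ae_mem_modExtinct (Z : BlockLHBP d) {A : Set (Ty d)} {l : ℤ}
    (hA : ∀ x ∈ levelsUpTo d l, ∃ y ∈ A, Relation.ReflTransGen (fun a b => 0 < Z.mean a b) x y)
    (k : ℤ) (i : Ty d) :
    ∀ᵐ N ∂Z.prob, N ∈ absentFrom 0 A i → N ∈ modExtinct k l A i := by
  have h_dies : ∀ᵐ N ∂Z.prob, ∀ x ∈ levelsUpTo d l, N ∈ absentFrom 0 A i →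
      ∀ᶠ m in atTop, population N i m x = 0 := by
    refine (ae_ball_iff (Set.to_countable _)).2 fun x hx => ?_
    obtain ⟨y, hy, hxy⟩ := hA x hx
    exact Z.ae_eventually_population_eq_zero hxy hy 0 i
  filter_upwards [h_dies] with N h_dies hN
  exact mem_modExtinct_of_eventually hN
    ((finite_levelsUpTo l).eventually_all.2 fun x hx => h_dies x hx hN)

end Branching

theorem mainTheorem11_general (d : ℕ) (Z : Branching.BlockLHBP d) (A : Set (Branching.Ty d))
    (hA : ∀ x, ∃ y ∈ A, Relation.ReflTransGen (fun a b => 0 < Z.mean a b) x y) :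
    Filter.Tendsto (fun l : ℕ => Z.qMod (-1) (l : ℤ) A) Filter.atTop (nhds (Z.qAbsent 0 A)) := by
  refine tendsto_pi_nhds.2 fun i => (ENNReal.tendsto_toReal (measure_ne_top _ _)).comp ?_
  refine tendsto_measure_of_ae_tendsto_indicator_of_isFiniteMeasure atTop
    (Branching.measurableSet_absentFrom 0 A i)
    (fun l : ℕ => Branching.measurableSet_modExtinct (-1) l A i) ?_
  filter_upwards [ae_all_iff.2 fun l : ℕ => Z.ae_mem_modExtinct (fun x _ => hA x) (-1) i] with N hN
  by_cases h_absent : N ∈ Branching.absentFrom 0 A i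
  · exact .of_forall fun l => iff_of_true (hN l h_absent) h_absent
  · exact (Branching.eventually_notMem_modExtinct h_absent).mono fun l hl =>
      iff_of_false hl h_absent

theorem mainTheorem11 (d : ℕ) (hd : 1 ≤ d) (Z : Branching.BlockLHBP d) (hZ : Z.Irreducible)
    (A : Set (Branching.Ty d)) (hA : A.Nonempty) :
    Filter.Tendsto (fun l : ℕ => Z.qMod (-1) (l : ℤ) A) Filter.atTop (nhds (Z.qAbsent 0 A)) := by
  obtain ⟨y, hy⟩ := hA
  exact mainTheorem11_general d Z A fun x => ⟨y, hy, hZ x y⟩
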